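/- All graphs are finite and simple, and $\mathrm{dist}$ is the graph distance. A set $D\subseteq V(G)$ is a *dominating set* if every vertex not in $D$ is adjacent to a vertex of $D$, and a *distance-$2$ dominating set* if every vertex not in $D$ is at distance at most $2$ from a vertex of $D$; $\gamma(G)$ and $\gamma_2(G)$ denote the minimum cardinalities of such sets. A *configuration* of $m$ guards is a multiset of $m$ vertices (several guards may occupy the same vertex). An *eternal distance-$2$ dominating family* with $m$ guards is a nonempty collection $\mathcal E$ of configurations of $m$ guards, each of which occupies a distance-$2$ dominating set, such that for every $D\in\mathcal E$ and every (attacked) vertex $v$ there is $D'\in\mathcal E$ containing $v$ and a perfect matching between $D$ and $D'$ whose matched vertices are at distance at most $2$. Thus the guards, all of which may move at each step, can answer every infinite sequence of attacks. The *eternal distance-$2$ domination number* $\gamma_{all,2}^\infty(G)$ is the least $m$ for which such a family exists. A *leaf* is a vertex of degree $1$ and a *stem* is a vertex adjacent to a leaf. Let $\mathbb T$ be the family of trees, up to isomorphism, consisting of the one-vertex path $P_1$ together with all trees obtained from the two-vertex path $P_2$ by a finite (possibly empty) sequence of the following operations, each applied to a tree $T$ obtained so far: * $\mathbb T_1$: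 add a new vertex $x_1$ and the edge $x_1y$, where $y$ is a stem of $T$; * $\mathbb T_2$: add a new path $(x_1,x_2,x_3)$ and the edge $x_1y$, where $y\in V(T)$ is neither a leaf nor a stem of $T$; * $\mathbb T_3$: add a new path $(x_1,x_2,x_3,x_4)$ and the edge $x_1y$, where $y$ is a stem of $T$. **Theorem.** Let $T$ be a tree. Then $\gamma_{all,2}^\infty(T)=\gamma_2(T)$ if and only if $T\in\mathbb T$. Equivalently, $\gamma_{all,2}^\infty(T)=\gamma_2(T)$ if and only if $\gamma(T)=\gamma_2(T)$. -/

import Mathlib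

namespace EternalDomination

universe u

section Domination

variable {V : Type u} (G : SimpleGraph V)

/-- `D` is a dominating set: every vertex not in `D` is adjacent to a vertex of `D`. -/
def IsDominating (D : Set V) : Prop :=
  ∀ v, v ∉ D → ∃ w ∈ D, G.Adj v w

/-- `D` is a distance-`k` dominating set: every vertex not in `D` is at distance at most `k`
from a vertex of `D`. (The extended distance is `⊤` between different components.) -/
def IsDistDominating (k : ℕ) (D : Set V) : Prop :=
  ∀ v, v ∉ D → ∃ w ∈ D, G.edist v w ≤ k

/-- The domination number `γ(G)` of a finite graph. -/
noncomputable def dominationNumber : ℕ :=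
  sInf {m | ∃ D : Finset V, D.card = m ∧ IsDominating G (D : Set V)}

/-- The distance-`k` domination number `γ_k(G)` of a finite graph. -/
noncomputable def distDominationNumber (k : ℕ) : ℕ :=
  sInf {m | ∃ D : Finset V, D.card = m ∧ IsDistDominating G k (D : Set V)}

/-- `D'` can be reached from the guard configuration `D` in one move: the guards of `D` and those
of `D'` can be matched up so that matched positions are at distance at most `k`. Configurations
are multisets, since several guards may stand on one vertex; all guards may move. -/
def CanMove (k : ℕ) (D D' : Multiset V) : Prop :=
  Multiset.Rel (fun x y => G.edist x y ≤ k) D D'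

/-- `𝓔` is an eternal distance-`k` dominating family with `m` guards: a nonempty collection of
distance-`k` dominating configurations of `m` guards such that, from each of them and for each
attacked vertex `v`, one move leads to a configuration of the collection that occupies `v`.
Thus guards that start in `𝓔` answer every infinite sequence of attacks, revealed one at a time. -/
structure IsEternalFamily (k m : ℕ) (𝓔 : Set (Multiset V)) : Prop where
  nonempty : 𝓔.Nonempty
  card_eq : ∀ D ∈ 𝓔, Multiset.card D = m
  dominating : ∀ D ∈ 𝓔, IsDistDominating G k {v | v ∈ D}
  respond : ∀ D ∈ 𝓔, ∀ v : V, ∃ D' ∈ 𝓔, v ∈ D' ∧ CanMove G k D D'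

/-- The eternal distance-`k` domination number `γ_{all,k}^∞(G)` of a finite graph. -/
noncomputable def eternalDistDominationNumber (k : ℕ) : ℕ :=
  sInf {m | ∃ 𝓔 : Set (Multiset V), IsEternalFamily G k m 𝓔}

end Domination

section Family

variable {V : Type u} (G : SimpleGraph V)

/-- A leaf: a vertex of degree one. -/
def IsLeaf (v : V) : Prop := ∃! w, G.Adj v w

/-- A stem: a vertex adjacent to a leaf. -/
def IsStem (v : V) : Prop := ∃ w, G.Adj v w ∧ IsLeaf G w

/-- The graph obtained from `G` by adding a new path `(x₁, …, x_{n+1})` on `n + 1` vertices and the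
edge between `x₁` and the vertex `y` of `G`. -/
def appendPath (y : V) (n : ℕ) : SimpleGraph (V ⊕ Fin (n + 1)) :=
  (G ⊕g SimpleGraph.pathGraph (n + 1)) ⊔ SimpleGraph.edge (Sum.inl y) (Sum.inr 0)

/-- The graphs obtained, up to isomorphism, from the path `P₂` by finitely many (possibly zero)
operations `𝕋₁`, `𝕋₂`, `𝕋₃`. -/
inductive Generated : (V : Type u) → SimpleGraph V → Prop
  | base {V : Type u} {T : SimpleGraph V} :
      Nonempty (T ≃g SimpleGraph.pathGraph 2) → Generated V T
  | op₁ {V W : Type u} {T : SimpleGraph V} {T' : SimpleGraph W} (y : V) :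
      Generated V T → IsStem T y → Nonempty (T' ≃g appendPath T y 0) → Generated W T'
  | op₂ {V W : Type u} {T : SimpleGraph V} {T' : SimpleGraph W} (y : V) :
      Generated V T → ¬ IsLeaf T y → ¬ IsStem T y → Nonempty (T' ≃g appendPath T y 2) →
        Generated W T'
  | op₃ {V W : Type u} {T : SimpleGraph V} {T' : SimpleGraph W} (y : V) :
      Generated V T → IsStem T y → Nonempty (T' ≃g appendPath T y 3) → Generated W T'

/-- Membership in the family `𝕋`: the graphs generated from `P₂`, together with `P₁`. -/
def InFamily : Prop :=
  Nonempty (G ≃g SimpleGraph.pathGraph 1) ∨ Generated V G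

end Family

end EternalDomination

/-! The inequalities γ₂ ≤ γ_all,2^∞ ≤ γ hold for every finite graph. The second is
`IsDominating.exists_isEternalFamily`: a guard confined to a closed neighbourhood can reach all of
it in one move of length two. So γ = γ₂ forces equality throughout, and two implications remain.

Members of 𝕋 satisfy γ = γ₂. All generated trees carry the invariant `HasLeafPacking`: at least γ
leaves pairwise more than four apart. No guard is within two of two such leaves, hence γ ≤ γ₂
(`card_le_distDominationNumber`).

Conversely, trees with γ_all,2^∞ = γ₂ lie in 𝕋, by strong induction on the order. Near a deepest
vertex of a rooted tree (`tree_decomposition`), either one guard can replace two that some attack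
forces (`eternal_ne_of_replace`), which makes equality impossible, or a leaf at a stem or a pendant
P₃ splits off. Removing a P₃ or P₄ lowers γ_all,2^∞ by at least one
(`eternal_add_one_le_appendPath`) and γ₂ by at most one, so the rest inherits equality. It remains
to see where a P₃ is attached. At a stem, or at a one-vertex tree, `eternal_ne_appendPath_two` rules
it out. At a leaf, the leaf and the P₃ form a P₄ attached to the leaf's neighbour, which must be a
stem by `distDominationNumber_appendPath_three_le`; this is 𝕋₃. All other positions are 𝕋₂. -/

namespace EternalDomination

universe u v

open SimpleGraph

/-! ### Weak homomorphisms and extended distances -/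

section Retraction

variable {V : Type u} {W : Type v} {G : SimpleGraph V} {H : SimpleGraph W}

/-- A weak homomorphism sends adjacent vertices to adjacent or equal vertices. -/
def IsWeakHom (G : SimpleGraph V) (H : SimpleGraph W) (f : V → W) : Prop :=
  ∀ a b, G.Adj a b → f a = f b ∨ H.Adj (f a) (f b)

lemma IsWeakHom.edist_le {f : V → W} (hf : IsWeakHom G H f) (a b : V) :
    H.edist (f a) (f b) ≤ G.edist a b := by
  by_cases h : G.Reachable a b
  · obtain ⟨p, hp⟩ := h.exists_walk_length_eq_edist
    rw [← hp]
    clear hp h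
    induction p with
    | nil => simp
    | @cons x y z hxy p ih =>
      refine (H.edist_triangle (v := f y)).trans ?_
      rw [Walk.length_cons, Nat.cast_add, Nat.cast_one, add_comm]
      refine add_le_add ih ?_
      rw [edist_le_one_iff_adj_or_eq]
      exact (hf x y hxy).symm
  · rw [edist_eq_top_of_not_reachable h]
    exact le_top

lemma isWeakHom_iso (e : G ≃g H) : IsWeakHom G H e :=
  fun _ _ h => Or.inr (e.map_rel_iff.2 h)

lemma edist_iso (e : G ≃g H) (a b : V) : H.edist (e a) (e b) = G.edist a b := by
  refine le_antisymm ((isWeakHom_iso e).edist_le a b) ?_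
  simpa using (isWeakHom_iso e.symm).edist_le (e a) (e b)

/-- A potential that grows by at most one along edges is bounded by the distance. -/
lemma le_add_edist {φ : V → ℕ∞} (hφ : ∀ a b, G.Adj a b → φ b ≤ φ a + 1) (a b : V) :
    φ b ≤ φ a + G.edist a b := by
  by_cases h : G.Reachable a b
  · obtain ⟨p, hp⟩ := h.exists_walk_length_eq_edist
    rw [← hp]
    clear hp h
    induction p with
    | nil => simp
    | @cons x y z hxy p ih =>
      refine ih.trans ?_
      rw [Walk.length_cons, Nat.cast_add, Nat.cast_one, add_comm (p.length : ℕ∞), ← add_assoc]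
      gcongr
      exact hφ x y hxy
  · rw [edist_eq_top_of_not_reachable h]
    simp

lemma edist_le_two_iff {a b : V} :
    G.edist a b ≤ 2 ↔ a = b ∨ G.Adj a b ∨ ∃ c, G.Adj a c ∧ G.Adj c b := by
  constructor
  · intro h
    by_contra! hc
    refine absurd h (not_le.2 (two_lt_edist_iff.2 ⟨hc.1, hc.2.1, ?_⟩))
    ext c
    simp only [mem_commonNeighbors, Set.mem_empty_iff_false, iff_false, not_and]
    exact fun h1 h2 => hc.2.2 c h1 h2.symm
  · rintro (rfl | h | ⟨c, h1, h2⟩)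
    · simp
    · rw [edist_eq_one_iff_adj.2 h]
      norm_num
    · refine (G.edist_triangle (v := c)).trans ?_
      rw [edist_eq_one_iff_adj.2 h1, edist_eq_one_iff_adj.2 h2]
      norm_num

lemma edist_le_two_of_le_one {a b c : V} (h1 : G.edist a b ≤ 1) (h2 : G.edist b c ≤ 1) :
    G.edist a c ≤ 2 :=
  (G.edist_triangle (v := b)).trans ((add_le_add h1 h2).trans (by norm_num))

end Retraction

/-! ### The three domination numbers: comparison, monotonicity, obstructions -/

section Numbers

variable {V : Type u} {W : Type v} {G : SimpleGraph V} {H : SimpleGraph W}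

lemma dominationNumber_le {D : Finset V} (hD : IsDominating G (D : Set V)) :
    dominationNumber G ≤ D.card :=
  Nat.sInf_le ⟨D, rfl, hD⟩

lemma distDominationNumber_le {k : ℕ} {D : Finset V} (hD : IsDistDominating G k (D : Set V)) :
    distDominationNumber G k ≤ D.card :=
  Nat.sInf_le ⟨D, rfl, hD⟩

lemma exists_isDominating_card (G : SimpleGraph V) [Finite V] :
    ∃ D : Finset V, D.card = dominationNumber G ∧ IsDominating G (D : Set V) := by
  classical
  have := Fintype.ofFinite V
  exact Nat.sInf_mem (s := {m | ∃ D : Finset V, D.card = m ∧ IsDominating G (D : Set V)})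
    ⟨_, Finset.univ, rfl, fun v hv => absurd (by simp) hv⟩

lemma exists_isDistDominating_card (G : SimpleGraph V) (k : ℕ) [Finite V] :
    ∃ D : Finset V, D.card = distDominationNumber G k ∧ IsDistDominating G k (D : Set V) := by
  classical
  have := Fintype.ofFinite V
  exact Nat.sInf_mem (s := {m | ∃ D : Finset V, D.card = m ∧ IsDistDominating G k (D : Set V)})
    ⟨_, Finset.univ, rfl, fun v hv => absurd (by simp) hv⟩

lemma IsDistDominating.exists_edist_le {k : ℕ} {D : Set V} (hD : IsDistDominating G k D) (x : V) :
    ∃ w ∈ D, G.edist x w ≤ k := by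
  by_cases hx : x ∈ D
  · exact ⟨x, hx, by simp⟩
  · exact hD x hx

lemma IsDominating.exists_edist_le {D : Set V} (hD : IsDominating G D) (x : V) :
    ∃ w ∈ D, G.edist x w ≤ 1 := by
  by_cases hx : x ∈ D
  · exact ⟨x, hx, by simp⟩
  · obtain ⟨w, hw, h⟩ := hD x hx
    exact ⟨w, hw, (edist_eq_one_iff_adj.2 h).le⟩

lemma isDominating_of_edist_le {D : Set V} (h : ∀ x, ∃ w ∈ D, G.edist x w ≤ 1) :
    IsDominating G D := by
  intro x hx
  obtain ⟨w, hw, hd⟩ := h x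
  refine ⟨w, hw, (edist_le_one_iff_adj_or_eq.1 hd).resolve_right ?_⟩
  rintro rfl
  exact hx hw

/-- The domination condition of an eternal family follows from its response condition. -/
lemma isEternalFamily_of_respond {k m : ℕ} {𝓔 : Set (Multiset V)} (hne : 𝓔.Nonempty)
    (hcard : ∀ D ∈ 𝓔, Multiset.card D = m)
    (hr : ∀ D ∈ 𝓔, ∀ x : V, ∃ D' ∈ 𝓔, x ∈ D' ∧ CanMove G k D D') : IsEternalFamily G k m 𝓔 where
  nonempty := hne
  card_eq := hcard
  respond := hr
  dominating D hD x _ := by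
    obtain ⟨D', -, hx, hmove⟩ := hr D hD x
    obtain ⟨E, rfl⟩ := Multiset.exists_cons_of_mem hx
    obtain ⟨w, D₁, hw, -, rfl⟩ := Multiset.rel_cons_right.1 hmove
    exact ⟨w, by simp, by rwa [edist_comm]⟩

/-- Guards that stay in the closed neighbourhoods of a dominating set defend forever. -/
lemma IsDominating.exists_isEternalFamily {D : Finset V} (hD : IsDominating G (D : Set V)) :
    ∃ 𝓔, IsEternalFamily G 2 D.card 𝓔 := by
  classical
  refine ⟨{C | ∃ f : V → V, (∀ d ∈ D, G.edist (f d) d ≤ 1) ∧ C = D.val.map f},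
    isEternalFamily_of_respond ⟨_, id, by simp, rfl⟩ ?_ ?_⟩
  · rintro _ ⟨f, -, rfl⟩
    simp
  · rintro _ ⟨f, hf, rfl⟩ x
    obtain ⟨w, hw, hx⟩ := hD.exists_edist_le x
    -- Only the guard assigned to `w` moves, from one point of the closed neighbourhood of `w` to
    -- another, so through at most two edges.
    refine ⟨_, ⟨Function.update f w x, ?_, rfl⟩, ?_, ?_⟩
    · intro d hd
      by_cases h : d = w
      · subst h
        simpa using hx
      · simpa [h] using hf d hd
    · exact Multiset.mem_map.2 ⟨w, hw, by simp⟩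
    · refine Multiset.rel_map.2 (Multiset.rel_refl_of_refl_on fun d hd => ?_)
      by_cases h : d = w
      · subst h
        simpa using edist_le_two_of_le_one (hf d hd) (by rwa [edist_comm])
      · simp [h]

/-- Needed because `sInf ∅ = 0`: without a witness the infimum need not be attained. -/
lemma eternal_set_nonempty (G : SimpleGraph V) [Finite V] :
    {m | ∃ 𝓔 : Set (Multiset V), IsEternalFamily G 2 m 𝓔}.Nonempty := by
  have := Fintype.ofFinite V
  have hD : IsDominating G ((Finset.univ : Finset V) : Set V) := fun v hv => absurd (by simp) hv
  exact ⟨_, hD.exists_isEternalFamily⟩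

lemma exists_isEternalFamily (G : SimpleGraph V) [Finite V] :
    ∃ 𝓔 : Set (Multiset V), IsEternalFamily G 2 (eternalDistDominationNumber G 2) 𝓔 :=
  Nat.sInf_mem (eternal_set_nonempty G)

lemma eternalDistDominationNumber_le {m : ℕ} {𝓔 : Set (Multiset V)}
    (h : IsEternalFamily G 2 m 𝓔) : eternalDistDominationNumber G 2 ≤ m :=
  Nat.sInf_le ⟨𝓔, h⟩

lemma eternalDistDominationNumber_le_dominationNumber (G : SimpleGraph V) [Finite V] :
    eternalDistDominationNumber G 2 ≤ dominationNumber G := by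
  obtain ⟨D, hc, hD⟩ := exists_isDominating_card G
  obtain ⟨𝓔, h⟩ := hD.exists_isEternalFamily
  exact hc ▸ eternalDistDominationNumber_le h

lemma distDominationNumber_le_card {k : ℕ} {D : Multiset V}
    (hD : IsDistDominating G k {x | x ∈ D}) : distDominationNumber G k ≤ Multiset.card D := by
  classical
  have hset : (D.toFinset : Set V) = {x | x ∈ D} := by
    ext x
    simp
  exact (distDominationNumber_le (hset ▸ hD)).trans (Multiset.toFinset_card_le D)

lemma distDominationNumber_le_eternal (G : SimpleGraph V) [Finite V] :
    distDominationNumber G 2 ≤ eternalDistDominationNumber G 2 := by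
  obtain ⟨𝓔, h⟩ := exists_isEternalFamily G
  obtain ⟨D, hD⟩ := h.nonempty
  exact h.card_eq D hD ▸ distDominationNumber_le_card (h.dominating D hD)

section Monotone

variable {r : V → W}

lemma dominationNumber_le_of_surjective [Finite V] (hr : IsWeakHom G H r)
    (hs : Function.Surjective r) : dominationNumber H ≤ dominationNumber G := by
  classical
  obtain ⟨D, hc, hD⟩ := exists_isDominating_card G
  rw [← hc]
  refine (dominationNumber_le (D := D.image r) (isDominating_of_edist_le fun x => ?_)).trans
    Finset.card_image_le
  obtain ⟨x, rfl⟩ := hs x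
  obtain ⟨w, hw, h⟩ := hD.exists_edist_le x
  exact ⟨r w, by simpa using ⟨w, hw, rfl⟩, (hr.edist_le x w).trans h⟩

lemma distDominationNumber_le_of_surjective (k : ℕ) [Finite V] (hr : IsWeakHom G H r)
    (hs : Function.Surjective r) : distDominationNumber H k ≤ distDominationNumber G k := by
  classical
  obtain ⟨D, hc, hD⟩ := exists_isDistDominating_card G k
  rw [← hc]
  refine (distDominationNumber_le (D := D.image r) fun x _ => ?_).trans Finset.card_image_le
  obtain ⟨x, rfl⟩ := hs x
  obtain ⟨w, hw, h⟩ := hD.exists_edist_le x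
  exact ⟨r w, by simpa using ⟨w, hw, rfl⟩, (hr.edist_le x w).trans h⟩

/-- Guards on `H` shadow guards on `G`: an attack is lifted along `r`, answered in `G`, and the
answer projected, which does not lengthen moves. Multiset configurations are essential here, since
`r` may merge positions. -/
lemma eternalDistDominationNumber_le_of_surjective [Finite V] (hr : IsWeakHom G H r)
    (hs : Function.Surjective r) :
    eternalDistDominationNumber H 2 ≤ eternalDistDominationNumber G 2 := by
  obtain ⟨𝓔, h⟩ := exists_isEternalFamily G
  refine eternalDistDominationNumber_le (𝓔 := Multiset.map r '' 𝓔)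
    (isEternalFamily_of_respond (h.nonempty.image _) ?_ ?_)
  · rintro _ ⟨D, hD, rfl⟩
    simpa using h.card_eq D hD
  · rintro _ ⟨D, hD, rfl⟩ x
    obtain ⟨x, rfl⟩ := hs x
    obtain ⟨D', hD', hx, hmove⟩ := h.respond D hD x
    refine ⟨_, ⟨D', hD', rfl⟩, Multiset.mem_map_of_mem r hx, Multiset.rel_map.2 ?_⟩
    exact Multiset.Rel.mono hmove fun a _ b _ hab => (hr.edist_le a b).trans hab

end Monotone

lemma dominationNumber_congr [Finite V] [Finite W] (e : G ≃g H) :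
    dominationNumber G = dominationNumber H :=
  le_antisymm (dominationNumber_le_of_surjective (isWeakHom_iso e.symm) e.symm.surjective)
    (dominationNumber_le_of_surjective (isWeakHom_iso e) e.surjective)

lemma distDominationNumber_congr (k : ℕ) [Finite V] [Finite W] (e : G ≃g H) :
    distDominationNumber G k = distDominationNumber H k :=
  le_antisymm (distDominationNumber_le_of_surjective k (isWeakHom_iso e.symm) e.symm.surjective)
    (distDominationNumber_le_of_surjective k (isWeakHom_iso e) e.surjective)

lemma eternalDistDominationNumber_congr [Finite V] [Finite W] (e : G ≃g H) :
    eternalDistDominationNumber G 2 = eternalDistDominationNumber H 2 :=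
  le_antisymm (eternalDistDominationNumber_le_of_surjective (isWeakHom_iso e.symm) e.symm.surjective)
    (eternalDistDominationNumber_le_of_surjective (isWeakHom_iso e) e.surjective)

/-- If one guard at `c` could replace two guards that are forced to defend `a` and `b` at the same
time, then eternal domination needs more guards than domination. -/
lemma eternal_ne_of_replace [Finite V] {a b c : V} (hab : ¬ G.edist b a ≤ 2)
    (ha : ∀ u, G.edist a u ≤ 2 → G.edist c u ≤ 2)
    (hb : ∀ z, G.edist b z ≤ 2 → ∀ u, G.edist z u ≤ 2 → G.edist c u ≤ 2) :
    eternalDistDominationNumber G 2 ≠ distDominationNumber G 2 := by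
  intro heq
  obtain ⟨𝓔, h⟩ := exists_isEternalFamily G
  obtain ⟨D, hD⟩ := h.nonempty
  obtain ⟨D', hD', haD, -⟩ := h.respond D hD a
  have hcard := h.card_eq D' hD'
  have hdom := h.dominating D' hD'
  obtain ⟨z, hz, hbz⟩ := hdom.exists_edist_le b
  obtain ⟨E, rfl⟩ := Multiset.exists_cons_of_mem haD
  -- The guard answering the attack on `a` is too far from `b`, so the guard covering `b` is another
  -- one; these two are then traded for the single guard `c`.
  have hzE : z ∈ E := by
    rcases Multiset.mem_cons.1 hz with rfl | h'
    · exact absurd hbz hab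
    · exact h'
  obtain ⟨F, rfl⟩ := Multiset.exists_cons_of_mem hzE
  have hle : distDominationNumber G 2 ≤ Multiset.card (c ::ₘ F) := by
    refine distDominationNumber_le_card fun x _ => ?_
    obtain ⟨w, hw, hxw⟩ := hdom.exists_edist_le x
    rw [edist_comm] at hxw
    rcases Multiset.mem_cons.1 hw with rfl | hw
    · exact ⟨c, by simp, by rw [edist_comm]; exact ha x hxw⟩
    rcases Multiset.mem_cons.1 hw with rfl | hw
    · exact ⟨c, by simp, by rw [edist_comm]; exact hb w hbz x hxw⟩
    · exact ⟨w, by simp [hw], by rwa [edist_comm]⟩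
  simp only [Multiset.card_cons] at hcard hle
  omega

/-- Pairwise far vertices need distinct guards. -/
lemma card_le_distDominationNumber [Finite V] {P : Finset V}
    (hP : ∀ p ∈ P, ∀ q ∈ P, p ≠ q → 4 < G.edist p q) : P.card ≤ distDominationNumber G 2 := by
  obtain ⟨D, hc, hD⟩ := exists_isDistDominating_card G 2
  rw [← hc]
  choose f hf hd using fun x => hD.exists_edist_le x
  refine Finset.card_le_card_of_injOn f (fun x _ => hf x) fun p hp q hq hpq => ?_
  by_contra hne
  -- A shared guard would put `p` and `q` within 2 + 2 of each other.
  refine absurd (hP p hp q hq hne) (not_lt.2 ((G.edist_triangle (v := f p)).trans ?_))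
  refine (add_le_add (hd p) (?_ : _ ≤ ((2 : ℕ) : ℕ∞))).trans (by norm_num)
  rw [hpq, edist_comm]
  exact hd q

end Numbers

/-! ### Appending a path: distances and effect on the domination numbers -/

section AppendPath

variable {V : Type u} {G : SimpleGraph V} {y : V} {n : ℕ}

@[simp]
lemma appendPath_adj_inl_inl {a b : V} :
    (appendPath G y n).Adj (.inl a) (.inl b) ↔ G.Adj a b := by
  simp [appendPath, edge_adj]

@[simp]
lemma appendPath_adj_inr_inr {i j : Fin (n + 1)} :
    (appendPath G y n).Adj (.inr i) (.inr j) ↔ (pathGraph (n + 1)).Adj i j := by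
  simp [appendPath, edge_adj]

@[simp]
lemma appendPath_adj_inl_inr {a : V} {i : Fin (n + 1)} :
    (appendPath G y n).Adj (.inl a) (.inr i) ↔ a = y ∧ i = 0 := by
  simp [appendPath, edge_adj, eq_comm]

@[simp]
lemma appendPath_adj_inr_inl {a : V} {i : Fin (n + 1)} :
    (appendPath G y n).Adj (.inr i) (.inl a) ↔ a = y ∧ i = 0 := by
  rw [adj_comm, appendPath_adj_inl_inr]

/-- The retraction of `appendPath G y n` onto `G` that sends the path to `y`. -/
def retract (y : V) (n : ℕ) : V ⊕ Fin (n + 1) → V := Sum.elim id fun _ => y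

@[simp] lemma retract_inl (y : V) (n : ℕ) (a : V) : retract y n (.inl a) = a := rfl

@[simp] lemma retract_inr (y : V) (n : ℕ) (i : Fin (n + 1)) : retract y n (.inr i) = y := rfl

lemma retract_surjective (y : V) (n : ℕ) : Function.Surjective (retract y n) :=
  fun a => ⟨.inl a, rfl⟩

lemma isWeakHom_retract : IsWeakHom (appendPath G y n) G (retract y n) := by
  rintro (a | i) (b | j) h
  · exact .inr (by simpa using h)
  · exact .inl (by simpa using (appendPath_adj_inl_inr.1 h).1)
  · exact .inl (by simpa using (appendPath_adj_inr_inl.1 h).1.symm)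
  · exact .inl rfl

@[simp]
lemma edist_inl_inl (a b : V) : (appendPath G y n).edist (.inl a) (.inl b) = G.edist a b := by
  refine le_antisymm ?_ (isWeakHom_retract.edist_le (G := appendPath G y n) (.inl a) (.inl b))
  have h : IsWeakHom G (appendPath G y n) Sum.inl := fun a b h => .inr (by simpa using h)
  exact h.edist_le a b

lemma edist_inr_inr_le {i j : Fin (n + 1)} (hij : i ≤ j) :
    (appendPath G y n).edist (.inr i) (.inr j) ≤ ((j - i : ℕ) : ℕ∞) := by
  obtain ⟨i, hi⟩ := i
  obtain ⟨j, hj⟩ := j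
  obtain ⟨k, rfl⟩ := Nat.exists_eq_add_of_le (show i ≤ j from hij)
  clear hij
  simp only [Nat.add_sub_cancel_left]
  induction k with
  | zero => simp
  | succ k ih =>
    refine ((appendPath G y n).edist_triangle (v := .inr ⟨i + k, by omega⟩)).trans ?_
    rw [Nat.cast_add, Nat.cast_one]
    refine add_le_add (ih (by omega)) (edist_eq_one_iff_adj.2 ?_).le
    rw [appendPath_adj_inr_inr, pathGraph_adj]
    left
    simp
    omega

lemma edist_inl_inr (a : V) (i : Fin (n + 1)) :
    (appendPath G y n).edist (.inl a) (.inr i) = G.edist a y + (i + 1 : ℕ) := by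
  apply le_antisymm
  · refine ((appendPath G y n).edist_triangle (v := .inl y)).trans ?_
    rw [edist_inl_inl]
    gcongr
    refine ((appendPath G y n).edist_triangle (v := .inr 0)).trans ?_
    rw [add_comm, Nat.cast_add, Nat.cast_one]
    refine add_le_add (by simpa using edist_inr_inr_le (G := G) (y := y) (Fin.zero_le i)) ?_
    exact (edist_eq_one_iff_adj.2 (by simp)).le
  · let φ : V ⊕ Fin (n + 1) → ℕ∞ :=
      Sum.elim (fun b => G.edist a b) fun j => G.edist a y + (j + 1 : ℕ)
    have hφ : ∀ s t, (appendPath G y n).Adj s t → φ t ≤ φ s + 1 := by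
      rintro (b | i) (c | j) h
      · refine (G.edist_triangle (v := b)).trans ?_
        simp only [φ, Sum.elim_inl]
        gcongr
        exact (edist_eq_one_iff_adj.2 (by simpa using h)).le
      · obtain ⟨rfl, rfl⟩ := appendPath_adj_inl_inr.1 h
        simp [φ]
      · obtain ⟨rfl, rfl⟩ := appendPath_adj_inr_inl.1 h
        simp only [φ, Sum.elim_inl, Sum.elim_inr, add_assoc]
        exact le_self_add
      · rw [appendPath_adj_inr_inr, pathGraph_adj] at h
        simp only [φ, Sum.elim_inr, add_assoc]
        gcongr
        norm_cast
        omega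
    simpa [φ] using le_add_edist hφ (.inl a) (.inr i)

/-- All interaction between the path and `G` within one move takes place between the closed
neighbourhood of `y` and the first two path vertices. -/
lemma edist_inl_inr_le_two {a : V} {i : Fin (n + 1)}
    (h : (appendPath G y n).edist (.inl a) (.inr i) ≤ 2) : G.edist a y ≤ 1 ∧ (i : ℕ) ≤ 1 := by
  rw [edist_inl_inr] at h
  cases hd : G.edist a y with
  | top => simp [hd] at h
  | coe d =>
    rw [hd] at h
    norm_cast at h ⊢
    omega

lemma edist_inl_inr_zero_le_two {a : V} (h : G.edist a y ≤ 1) :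
    (appendPath G y n).edist (.inl a) (.inr 0) ≤ 2 := by
  rw [edist_inl_inr]
  refine (add_le_add_left h _).trans ?_
  norm_num

lemma edist_inr_inr_le_of_le {i j : Fin (n + 1)} {k : ℕ} (hij : (i : ℕ) ≤ j + k)
    (hji : (j : ℕ) ≤ i + k) : (appendPath G y n).edist (.inr i) (.inr j) ≤ k := by
  rcases le_total i j with h | h
  · refine (edist_inr_inr_le h).trans ?_
    norm_cast
    omega
  · rw [edist_comm]
    refine (edist_inr_inr_le h).trans ?_
    norm_cast
    omega

lemma connected_appendPath (h : G.Connected) : (appendPath G y n).Connected :=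
  h.sum_sup_edge (pathGraph_connected n)

lemma isTree_of_isTree_appendPath (h : (appendPath G y n).IsTree) : G.IsTree where
  isAcyclic := by
    refine h.isAcyclic.comap (⟨Sum.inl, by simp⟩ : G →g appendPath G y n) Sum.inl_injective
  connected := by
    have : Nonempty V := ⟨y⟩
    refine ⟨fun a b => ?_⟩
    rw [← edist_ne_top_iff_reachable, ← edist_inl_inl (y := y) (n := n)]
    exact edist_ne_top_iff_reachable.2 (h.connected.preconnected _ _)

lemma isLeaf_inl {a : V} (ha : IsLeaf G a) (hy : a ≠ y) : IsLeaf (appendPath G y n) (.inl a) := by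
  obtain ⟨w, hw, hu⟩ := ha
  refine ⟨.inl w, by simpa using hw, ?_⟩
  rintro (b | i) h
  · exact congrArg _ (hu b (by simpa using h))
  · exact absurd (appendPath_adj_inl_inr.1 h).1 hy

lemma isLeaf_last : IsLeaf (appendPath G y n) (.inr (Fin.last n)) := by
  cases n with
  | zero =>
    refine ⟨.inl y, by simp, ?_⟩
    rintro (b | i) h
    · rw [(appendPath_adj_inr_inl.1 h).1]
    · rw [appendPath_adj_inr_inr, pathGraph_adj] at h
      omega
  | succ k =>
    refine ⟨.inr (Fin.last k).castSucc, by simp [pathGraph_adj], ?_⟩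
    rintro (b | i) h
    · exact absurd (appendPath_adj_inr_inl.1 h).2 (Fin.last_pos).ne'
    · rw [appendPath_adj_inr_inr, pathGraph_adj] at h
      simp only [Fin.val_last] at h
      congr 1
      ext
      simp
      omega

lemma exists_isStem_appendPath : ∃ s, IsStem (appendPath G y n) s := by
  obtain ⟨s, hs, -⟩ := isLeaf_last (G := G) (y := y) (n := n)
  exact ⟨s, _, hs.symm, isLeaf_last⟩

/-- With at least three path vertices, the far end is out of reach of `G`, so some guard always
stands on the path. Dropping one such guard and folding the others onto `G` leaves an eternal family
on `G`. -/
lemma eternal_add_one_le_appendPath [Finite V] (hn : 2 ≤ n) :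
    eternalDistDominationNumber G 2 + 1 ≤ eternalDistDominationNumber (appendPath G y n) 2 := by
  classical
  obtain ⟨𝓔, h⟩ := exists_isEternalFamily (appendPath G y n)
  set m := eternalDistDominationNumber (appendPath G y n) 2
  have hguard : ∀ D ∈ 𝓔, ∃ (i : Fin (n + 1)) (E : _), D = .inr i ::ₘ E := by
    intro D hD
    obtain ⟨w | i, hw, hd⟩ := (h.dominating D hD).exists_edist_le (.inr (Fin.last n))
    · rw [edist_comm] at hd
      have := (edist_inl_inr_le_two hd).2
      simp at this
      omega
    · exact ⟨i, Multiset.exists_cons_of_mem hw⟩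
  have hnear : ∀ (i : Fin (n + 1)) s, (appendPath G y n).edist (.inr i) s ≤ 2 →
      G.edist (retract y n s) y ≤ 1 := by
    rintro i (b | j) hs
    · rw [edist_comm] at hs
      exact (edist_inl_inr_le_two hs).1
    · simp
  have hm : 1 ≤ m := by
    obtain ⟨D, hD⟩ := h.nonempty
    obtain ⟨i, E, rfl⟩ := hguard D hD
    rw [← h.card_eq _ hD]
    simp
  have key : IsEternalFamily G 2 (m - 1)
      {C | ∃ D ∈ 𝓔, ∃ (i : Fin (n + 1)) (E : _), D = .inr i ::ₘ E ∧ C = E.map (retract y n)} := by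
    refine isEternalFamily_of_respond ?_ ?_ ?_
    · obtain ⟨D, hD⟩ := h.nonempty
      obtain ⟨i, E, rfl⟩ := hguard D hD
      exact ⟨_, _, hD, i, E, rfl, rfl⟩
    · rintro _ ⟨_, hD, i, E, rfl, rfl⟩
      have := h.card_eq _ hD
      simp only [Multiset.card_cons] at this
      simp only [Multiset.card_map]
      omega
    · rintro _ ⟨_, hD, i, E, rfl, rfl⟩ x
      obtain ⟨_, hD', hx, hmove⟩ := h.respond _ hD (.inl x)
      obtain ⟨j, E', rfl⟩ := hguard _ hD'
      refine ⟨_, ⟨_, hD', j, E', rfl, rfl⟩, Multiset.mem_map.2 ⟨.inl x, by simpa using hx, rfl⟩, ?_⟩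
      obtain ⟨b, F', hb, hF, hF'⟩ := Multiset.rel_cons_left.1 hmove
      -- The dropped guards before and after the move may differ. Then the old one goes from `i` to
      -- some `b`, while the new one comes to `j` from some `a`. Both `a` and `b` fold into the
      -- closed neighbourhood of `y`, so a single guard can go from the image of `a` to that of `b`.
      rcases Multiset.cons_eq_cons.1 hF' with ⟨-, rfl⟩ | ⟨-, E₀, rfl, rfl⟩
      · exact Multiset.rel_map.2 (hF.mono fun a _ b _ hab => (isWeakHom_retract.edist_le a b).trans hab)
      · obtain ⟨a, F, ha, hF₀, rfl⟩ := Multiset.rel_cons_right.1 hF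
        refine Multiset.rel_map.2 (Multiset.Rel.cons ?_ (hF₀.mono
          fun a _ b _ hab => (isWeakHom_retract.edist_le a b).trans hab))
        refine edist_le_two_of_le_one (hnear j a (by rwa [edist_comm])) ?_
        rw [edist_comm]
        exact hnear i b hb
  have := eternalDistDominationNumber_le key
  omega

/-- One guard on the second path vertex covers a path of at most four vertices. -/
lemma distDominationNumber_appendPath_le [Finite V] (hn : n ≤ 3) (hn' : 1 ≤ n) :
    distDominationNumber (appendPath G y n) 2 ≤ distDominationNumber G 2 + 1 := by
  classical
  obtain ⟨D, hc, hD⟩ := exists_isDistDominating_card G 2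
  rw [← hc]
  refine (distDominationNumber_le (D := insert (.inr ⟨1, by omega⟩) (D.image Sum.inl)) ?_).trans
    ((Finset.card_insert_le _ _).trans (Nat.add_le_add_right Finset.card_image_le 1))
  rintro (a | i) -
  · obtain ⟨w, hw, hd⟩ := hD.exists_edist_le a
    exact ⟨.inl w, by simpa using hw, by simpa using hd⟩
  · exact ⟨.inr ⟨1, by omega⟩, by simp, edist_inr_inr_le_of_le (by simp; omega) (by simp)⟩

lemma dominationNumber_appendPath_zero_le {D : Finset V} (hD : IsDominating G (D : Set V))
    (hy : y ∈ D) : dominationNumber (appendPath G y 0) ≤ D.card := by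
  classical
  refine (dominationNumber_le (D := D.image Sum.inl) ?_).trans Finset.card_image_le
  refine isDominating_of_edist_le ?_
  rintro (a | i)
  · obtain ⟨w, hw, hd⟩ := hD.exists_edist_le a
    exact ⟨.inl w, by simpa using hw, by simpa using hd⟩
  · refine ⟨.inl y, by simpa using hy, (edist_eq_one_iff_adj.2 ?_).le⟩
    simp [Fin.fin_one_eq_zero i]

lemma dominationNumber_appendPath_two_le [Finite V] :
    dominationNumber (appendPath G y 2) ≤ dominationNumber G + 1 := by
  classical
  obtain ⟨D, hc, hD⟩ := exists_isDominating_card G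
  rw [← hc]
  refine (dominationNumber_le (D := insert (.inr 1) (D.image Sum.inl)) ?_).trans
    ((Finset.card_insert_le _ _).trans (Nat.add_le_add_right Finset.card_image_le 1))
  refine isDominating_of_edist_le ?_
  rintro (a | i)
  · obtain ⟨w, hw, hd⟩ := hD.exists_edist_le a
    exact ⟨.inl w, by simpa using hw, by simpa using hd⟩
  · exact ⟨.inr 1, by simp, edist_inr_inr_le_of_le (by simp; omega) (by simp)⟩

lemma dominationNumber_appendPath_three_le {D : Finset V} (hD : IsDominating G (D : Set V))
    (hy : y ∈ D) : dominationNumber (appendPath G y 3) ≤ D.card + 1 := by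
  classical
  refine (dominationNumber_le (D := insert (.inr 2) (D.image Sum.inl)) ?_).trans
    ((Finset.card_insert_le _ _).trans (Nat.add_le_add_right Finset.card_image_le 1))
  refine isDominating_of_edist_le ?_
  rintro (a | i)
  · obtain ⟨w, hw, hd⟩ := hD.exists_edist_le a
    exact ⟨.inl w, by simpa using hw, by simpa using hd⟩
  · by_cases hi : i = 0
    · refine ⟨.inl y, by simpa using hy, (edist_eq_one_iff_adj.2 ?_).le⟩
      simp [hi]
    · have h0 : (i : ℕ) ≠ 0 := fun h => hi (Fin.ext h)
      have h2 : ((2 : Fin (3 + 1)) : ℕ) = 2 := rfl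
      refine ⟨.inr 2, by simp, edist_inr_inr_le_of_le ?_ ?_⟩ <;> omega

/-- A minimum dominating set can be chosen to contain a given stem. -/
lemma IsStem.exists_isDominating_mem [Finite V] (hy : IsStem G y) :
    ∃ D : Finset V, D.card ≤ dominationNumber G ∧ IsDominating G (D : Set V) ∧ y ∈ D := by
  classical
  obtain ⟨D, hc, hD⟩ := exists_isDominating_card G
  rw [← hc]
  obtain ⟨l, hyl, w, hw, hu⟩ := hy
  obtain rfl := hu y hyl.symm
  by_cases hyD : y ∈ D
  · exact ⟨D, le_rfl, hD, hyD⟩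
  have hlD : l ∈ D := by
    by_contra hl
    obtain ⟨z, hz, hlz⟩ := hD l hl
    obtain rfl := hu z hlz
    exact hyD hz
  -- If `y` is missing, its leaf `l` must belong to `D`; since `l` dominates only itself and `y`, it
  -- can be exchanged for `y`.
  refine ⟨insert y (D.erase l), (Finset.card_insert_le _ _).trans ?_, fun x hx => ?_, by simp⟩
  · rw [Finset.card_erase_of_mem hlD]
    have := Finset.card_pos.2 ⟨l, hlD⟩
    omega
  · simp only [Finset.coe_insert, Finset.coe_erase, Set.mem_insert_iff, Set.mem_sdiff,
      Set.mem_singleton_iff, Finset.mem_coe, not_or, not_and, not_not] at hx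
    by_cases hxl : x = l
    · exact ⟨y, by simp, hxl ▸ hyl.symm⟩
    obtain ⟨z, hz, hxz⟩ := hD x fun h => hxl (hx.2 h)
    refine ⟨z, ?_, hxz⟩
    have : z ≠ l := by
      rintro rfl
      exact hx.1 (hu x hxz.symm)
    simp [this]
    exact .inr hz

end AppendPath

/-! ### Transport along isomorphisms and recognition of appended paths -/

section Isomorphism

variable {V : Type u} {W : Type v} {G : SimpleGraph V} {H : SimpleGraph W}

lemma IsLeaf.map_iso (e : G ≃g H) {a : V} (ha : IsLeaf G a) : IsLeaf H (e a) := by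
  obtain ⟨w, hw, hu⟩ := ha
  refine ⟨e w, e.map_adj_iff.2 hw, fun z hz => ?_⟩
  rw [← hu (e.symm z) (e.map_adj_iff.1 (by simpa using hz))]
  simp

lemma IsStem.map_iso (e : G ≃g H) {a : V} (ha : IsStem G a) : IsStem H (e a) := by
  obtain ⟨w, hw, hl⟩ := ha
  exact ⟨e w, e.map_adj_iff.2 hw, hl.map_iso e⟩

/-- Isomorphisms extend to the graphs with an appended path. -/
def appendPathIso (e : G ≃g H) (y : V) (n : ℕ) : appendPath G y n ≃g appendPath H (e y) n where
  toEquiv := Equiv.sumCongr e.toEquiv (Equiv.refl _)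
  map_rel_iff' := by
    rintro (a | i) (b | j) <;> simp [e.map_adj_iff]

/-- Appending a vertex and then a path to it is the same as appending a longer path. -/
lemma nonempty_appendPath_appendPath_iso (y : V) (n : ℕ) :
    Nonempty (appendPath (appendPath G y 0) (.inr 0) n ≃g appendPath G y (n + 1)) := by
  let f : (V ⊕ Fin 1) ⊕ Fin (n + 1) → V ⊕ Fin (n + 2) :=
    Sum.elim (Sum.elim Sum.inl fun _ => .inr 0) fun i => .inr i.succ
  have hf : Function.Bijective f := by
    constructor
    · rintro ((a | i) | i) ((b | j) | j) h <;> simp [f] at h ⊢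
      · exact h
      · exact Subsingleton.elim _ _
      · exact absurd h.symm (Fin.succ_ne_zero _)
      · exact h
    · rintro (a | i)
      · exact ⟨.inl (.inl a), rfl⟩
      · cases i using Fin.cases with
        | zero => exact ⟨.inl (.inr 0), rfl⟩
        | succ i => exact ⟨.inr i, rfl⟩
  refine ⟨⟨Equiv.ofBijective f hf, ?_⟩⟩
  rintro ((a | i) | i) ((b | j) | j)
  · simp [f]
  · simp [f, Fin.fin_one_eq_zero]
  · simp [f]
  · simp [f, Fin.fin_one_eq_zero]
  · simp [f, Fin.fin_one_eq_zero]
  · obtain rfl := Fin.fin_one_eq_zero i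
    change (appendPath G y (n + 1)).Adj (.inr 0) (.inr j.succ) ↔ _
    rw [appendPath_adj_inl_inr, appendPath_adj_inr_inr, pathGraph_adj, Fin.val_succ, Fin.val_zero,
      ← Fin.val_eq_zero_iff]
    simp only [true_and]
    omega
  · simp [f]
  · obtain rfl := Fin.fin_one_eq_zero j
    change (appendPath G y (n + 1)).Adj (.inr i.succ) (.inr 0) ↔ _
    rw [appendPath_adj_inr_inl, appendPath_adj_inr_inr, pathGraph_adj, Fin.val_succ, Fin.val_zero,
      ← Fin.val_eq_zero_iff]
    simp only [true_and]
    omega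
  · simp [f, pathGraph_adj]

/-- A graph with a pendant path arises by appending that path to the rest of the graph. -/
lemma exists_iso_appendPath {n : ℕ} (f : Fin (n + 1) → V) (hf : Function.Injective f) {y : V}
    (hy : y ∈ (Set.range f)ᶜ) (hff : ∀ i j, G.Adj (f i) (f j) ↔ (pathGraph (n + 1)).Adj i j)
    (hvf : ∀ a ∈ (Set.range f)ᶜ, ∀ i, G.Adj a (f i) ↔ a = y ∧ i = 0) :
    ∃ e : G ≃g appendPath (G.induce (Set.range f)ᶜ) ⟨y, hy⟩ n, ∀ i, e (f i) = .inr i := by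
  let g : ((Set.range f)ᶜ : Set V) ⊕ Fin (n + 1) → V := Sum.elim Subtype.val f
  have hg : Function.Bijective g := by
    constructor
    · rintro (⟨a, ha⟩ | i) (⟨b, hb⟩ | j) h <;> simp [g] at h ⊢
      · exact h
      · exact absurd ⟨j, h.symm⟩ ha
      · exact absurd ⟨i, h⟩ hb
      · exact hf h
    · intro a
      by_cases ha : a ∈ Set.range f
      · obtain ⟨i, rfl⟩ := ha
        exact ⟨.inr i, rfl⟩
      · exact ⟨.inl ⟨a, ha⟩, rfl⟩
  refine ⟨Iso.symm ⟨Equiv.ofBijective g hg, ?_⟩,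
    fun i => (Equiv.ofBijective g hg).symm_apply_apply (.inr i)⟩
  rintro (⟨a, ha⟩ | i) (⟨b, hb⟩ | j)
  · simp [g]
  · simp [g, hvf a ha]
  · rw [adj_comm]
    simp [g, hvf b hb]
  · simp [g, hff]

end Isomorphism

/-! ### Members of the family satisfy γ = γ₂ -/

section Lower

variable {V : Type u} {G : SimpleGraph V}

/-- A walk ending at `a` can never have left the pair, as each of the two has only the other as
neighbour. So P₂ is the only connected graph in which a leaf is a stem. -/
lemma eq_or_eq_of_adj_leaves (hG : G.Connected) {a b : V} (hab : G.Adj a b) (ha : IsLeaf G a)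
    (hb : IsLeaf G b) (x : V) : x = a ∨ x = b := by
  obtain ⟨p⟩ := hG.preconnected x a
  induction p with
  | nil => exact .inl rfl
  | @cons x z a hxz p ih =>
    rcases ih hab ha with rfl | rfl
    · exact .inr (ha.unique hxz.symm hab)
    · exact .inl (hb.unique hxz.symm hab.symm)

/-- Every stem is avoided by a set of leaves at pairwise distance more than four that has at least
as many elements as a minimum dominating set. -/
def HasLeafPacking (G : SimpleGraph V) : Prop :=
  ∀ y, IsStem G y → ∃ P : Finset V, y ∉ P ∧ (∀ p ∈ P, IsLeaf G p) ∧
    (∀ p ∈ P, ∀ q ∈ P, p ≠ q → 4 < G.edist p q) ∧ dominationNumber G ≤ P.card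

lemma HasLeafPacking.of_iso {W : Type v} {H : SimpleGraph W} [Finite V] [Finite W]
    (h : HasLeafPacking G) (e : G ≃g H) : HasLeafPacking H := by
  intro y hy
  obtain ⟨P, hyP, hP, hd, hc⟩ := h (e.symm y) (hy.map_iso e.symm)
  refine ⟨P.map e.toEquiv.toEmbedding, ?_, ?_, ?_, ?_⟩
  · rw [Finset.mem_map_equiv]
    exact hyP
  · intro p hp
    have := (hP _ (Finset.mem_map_equiv.1 hp)).map_iso e
    rwa [show e (e.toEquiv.symm p) = p from e.toEquiv.apply_symm_apply p] at this
  · intro p hp q hq hpq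
    rw [← edist_iso e.symm]
    exact hd _ (Finset.mem_map_equiv.1 hp) _ (Finset.mem_map_equiv.1 hq)
      (e.symm.injective.ne hpq)
  · rw [Finset.card_map, ← dominationNumber_congr e]
    exact hc

lemma hasLeafPacking_pathGraph_two : HasLeafPacking (pathGraph 2) := by
  intro y _
  refine ⟨{y + 1}, by simp, fun p _ => ?_, by simp, ?_⟩
  · rw [pathGraph_two_eq_top]
    refine ⟨p + 1, by simp, fun q hq => ?_⟩
    have h2 : ∀ p q : Fin 2, p ≠ q → q = p + 1 := by decide
    exact h2 p q hq
  · refine (dominationNumber_le (D := {0}) fun a ha => ⟨0, by simp, ?_⟩).trans (by simp)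
    rw [pathGraph_two_eq_top, top_adj]
    simpa using ha

lemma HasLeafPacking.dominationNumber_eq [Finite V] (h : HasLeafPacking G) (hs : ∃ y, IsStem G y) :
    dominationNumber G = distDominationNumber G 2 := by
  obtain ⟨y, hy⟩ := hs
  obtain ⟨P, -, -, hP, hc⟩ := h y hy
  exact le_antisymm (hc.trans (card_le_distDominationNumber hP))
    ((distDominationNumber_le_eternal G).trans (eternalDistDominationNumber_le_dominationNumber G))

/-- There are at least three vertices: `a`, `b` and a new one. Hence any packing by leaves of the
enlarged graph avoids every stem automatically. -/
lemma not_isStem_of_isLeaf_appendPath (hG : G.Connected) {y : V} {n : ℕ} {a b : V}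
    (hab : G.Adj a b) {s : V ⊕ Fin (n + 1)} (hl : IsLeaf (appendPath G y n) s) :
    ¬ IsStem (appendPath G y n) s := by
  rintro ⟨t, hst, ht⟩
  have h := eq_or_eq_of_adj_leaves (connected_appendPath hG) hst hl ht
  have ha := h (.inl a)
  have hb := h (.inl b)
  have hc := h (.inr 0)
  have := hab.ne
  grind

variable {y : V}

/-- The old packing still works: it avoids `y`, so its members stay leaves, and a minimum dominating
set through `y` also dominates the new leaf. -/
lemma HasLeafPacking.appendPath_zero [Finite V] (h : HasLeafPacking G) (hG : G.Connected) (hy : IsStem G y) :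
    HasLeafPacking (appendPath G y 0) := by
  intro s hs
  obtain ⟨P, hyP, hP, hd, hc⟩ := h y hy
  obtain ⟨D, hD, hDd, hyD⟩ := hy.exists_isDominating_mem
  obtain ⟨l, hl, -⟩ := hy
  have hleaf : ∀ p ∈ P.map Function.Embedding.inl, IsLeaf (appendPath G y 0) p := by
    simp only [Finset.mem_map, Function.Embedding.inl_apply]
    rintro _ ⟨p, hp, rfl⟩
    exact isLeaf_inl (hP p hp) fun h => hyP (h ▸ hp)
  refine ⟨P.map .inl, fun hsP => not_isStem_of_isLeaf_appendPath hG hl (hleaf s hsP) hs, hleaf,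
    ?_, ?_⟩
  · simp only [Finset.mem_map, Function.Embedding.inl_apply]
    rintro _ ⟨p, hp, rfl⟩ _ ⟨q, hq, rfl⟩ hpq
    rw [edist_inl_inl]
    exact hd p hp q hq fun h => hpq (congrArg _ h)
  · rw [Finset.card_map]
    exact ((dominationNumber_appendPath_zero_le hDd hyD).trans hD).trans hc

/-- Common part of 𝕋₂ and 𝕋₃: the end of the new path joins the packing, which pays for the one
additional dominating vertex. -/
lemma HasLeafPacking.appendPath_of_far {n : ℕ} {P : Finset V} (hG : G.Connected) {a b : V}
    (hab : G.Adj a b) (hyP : y ∉ P) (hP : ∀ p ∈ P, IsLeaf G p)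
    (hd : ∀ p ∈ P, ∀ q ∈ P, p ≠ q → 4 < G.edist p q) (hfar : ∀ p ∈ P, 4 < G.edist p y + (n + 1 : ℕ))
    (hc : dominationNumber (appendPath G y n) ≤ P.card + 1) :
    HasLeafPacking (appendPath G y n) := by
  classical
  intro s hs
  have hleaf : ∀ p ∈ insert (.inr (Fin.last n)) (P.map Function.Embedding.inl),
      IsLeaf (appendPath G y n) p := by
    simp only [Finset.mem_insert, Finset.mem_map, Function.Embedding.inl_apply]
    rintro _ (rfl | ⟨p, hp, rfl⟩)
    · exact isLeaf_last
    · exact isLeaf_inl (hP p hp) fun h => hyP (h ▸ hp)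
  refine ⟨insert (.inr (Fin.last n)) (P.map .inl),
    fun hsP => not_isStem_of_isLeaf_appendPath hG hab (hleaf s hsP) hs, hleaf, ?_, ?_⟩
  · simp only [Finset.mem_insert, Finset.mem_map, Function.Embedding.inl_apply]
    rintro _ (rfl | ⟨p, hp, rfl⟩) _ (rfl | ⟨q, hq, rfl⟩) hpq
    · exact absurd rfl hpq
    · rw [edist_comm, edist_inl_inr]
      exact hfar q hq
    · rw [edist_inl_inr]
      exact hfar p hp
    · rw [edist_inl_inl]
      exact hd p hp q hq fun h => hpq (congrArg _ h)
  · rw [Finset.card_insert_of_notMem (by simp), Finset.card_map]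
    exact hc

lemma HasLeafPacking.appendPath_two [Finite V] (h : HasLeafPacking G) (hG : G.Connected)
    (hs : ∃ s, IsStem G s) (hyl : ¬ IsLeaf G y) (hys : ¬ IsStem G y) :
    HasLeafPacking (appendPath G y 2) := by
  obtain ⟨s, hs⟩ := hs
  obtain ⟨P, -, hP, hd, hc⟩ := h s hs
  obtain ⟨l, hl, -⟩ := hs
  refine appendPath_of_far hG hl (fun hyP => hyl (hP y hyP)) hP hd (fun p hp => ?_)
    (dominationNumber_appendPath_two_le.trans (Nat.add_le_add_right hc 1))
  -- As `y` is neither a leaf nor a stem, packed leaves are at least two away from it, and 2 + 3 >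
  -- 4.
  have h1 : ¬ G.edist p y ≤ 1 := by
    rw [edist_le_one_iff_adj_or_eq]
    rintro (hpy | rfl)
    · exact hys ⟨p, hpy.symm, hP p hp⟩
    · exact hyl (hP p hp)
  cases hpd : G.edist p y with
  | top => exact ENat.natCast_lt_top 4
  | coe d =>
    rw [hpd] at h1
    norm_cast at h1 ⊢
    omega

lemma HasLeafPacking.appendPath_three [Finite V] (h : HasLeafPacking G) (hG : G.Connected)
    (hy : IsStem G y) : HasLeafPacking (appendPath G y 3) := by
  obtain ⟨P, hyP, hP, hd, hc⟩ := h y hy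
  obtain ⟨D, hD, hDd, hyD⟩ := hy.exists_isDominating_mem
  obtain ⟨l, hl, -⟩ := hy
  refine appendPath_of_far hG hl hyP hP hd (fun p hp => ?_)
    ((dominationNumber_appendPath_three_le hDd hyD).trans (Nat.add_le_add_right (hD.trans hc) 1))
  -- The packing avoids `y`, so its leaves are at least one away, and 1 + 4 > 4.
  have h1 : G.edist p y ≠ 0 := by
    rw [Ne, edist_eq_zero_iff]
    rintro rfl
    exact hyP hp
  cases hpd : G.edist p y with
  | top => exact ENat.natCast_lt_top 4
  | coe d =>
    rw [hpd] at h1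
    norm_cast at h1 ⊢
    omega

lemma Generated.finite_connected_hasLeafPacking (h : Generated V G) :
    Finite V ∧ G.Connected ∧ (∃ s, IsStem G s) ∧ HasLeafPacking G := by
  induction h with
  | base h =>
    obtain ⟨e⟩ := h
    have hf := Finite.of_equiv _ e.symm.toEquiv
    refine ⟨hf, e.connected_iff.2 (pathGraph_connected 1), ⟨e.symm 0, ?_⟩,
      hasLeafPacking_pathGraph_two.of_iso e.symm⟩
    refine IsStem.map_iso e.symm ⟨1, by simp [pathGraph_adj], 0, by simp [pathGraph_adj], ?_⟩
    simp [pathGraph_adj]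
  | op₁ y _ hy h ih =>
    obtain ⟨e⟩ := h
    obtain ⟨hV, hG, -, hP⟩ := ih
    have hf := Finite.of_equiv _ e.symm.toEquiv
    obtain ⟨s, hs⟩ := exists_isStem_appendPath
    exact ⟨hf, e.connected_iff.2 (connected_appendPath hG), ⟨_, hs.map_iso e.symm⟩,
      (hP.appendPath_zero hG hy).of_iso e.symm⟩
  | op₂ y _ hl hy h ih =>
    obtain ⟨e⟩ := h
    obtain ⟨hV, hG, hs, hP⟩ := ih
    have hf := Finite.of_equiv _ e.symm.toEquiv
    obtain ⟨s, hs'⟩ := exists_isStem_appendPath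
    exact ⟨hf, e.connected_iff.2 (connected_appendPath hG), ⟨_, hs'.map_iso e.symm⟩,
      (hP.appendPath_two hG hs hl hy).of_iso e.symm⟩
  | op₃ y _ hy h ih =>
    obtain ⟨e⟩ := h
    obtain ⟨hV, hG, -, hP⟩ := ih
    have hf := Finite.of_equiv _ e.symm.toEquiv
    obtain ⟨s, hs⟩ := exists_isStem_appendPath
    exact ⟨hf, e.connected_iff.2 (connected_appendPath hG), ⟨_, hs.map_iso e.symm⟩,
      (hP.appendPath_three hG hy).of_iso e.symm⟩

/-- On a graph with at most one vertex all domination numbers agree. -/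
lemma dominationNumber_eq_of_subsingleton [Finite V] [Subsingleton V] :
    dominationNumber G = distDominationNumber G 2 := by
  refine le_antisymm ?_ ((distDominationNumber_le_eternal G).trans
    (eternalDistDominationNumber_le_dominationNumber G))
  obtain ⟨D, hc, hD⟩ := exists_isDistDominating_card G 2
  rw [← hc]
  refine dominationNumber_le fun x hx => ?_
  obtain ⟨w, hw, -⟩ := hD x hx
  exact absurd (Subsingleton.elim w x ▸ hw) hx

lemma InFamily.dominationNumber_eq [Finite V] (h : InFamily G) :
    dominationNumber G = distDominationNumber G 2 := by
  rcases h with ⟨⟨e⟩⟩ | h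
  · have : Subsingleton V := e.toEquiv.subsingleton
    exact dominationNumber_eq_of_subsingleton
  · obtain ⟨-, -, hs, hP⟩ := h.finite_connected_hasLeafPacking
    exact hP.dominationNumber_eq hs

end Lower

/-! ### Decomposing a tree at a deepest vertex; two obstructions -/

section Trees

variable {V : Type u} {T : SimpleGraph V}

lemma exists_adj_dist_add_one (hT : T.Connected) {r x : V} {k : ℕ} (h : T.dist r x = k + 1) :
    ∃ w, T.Adj x w ∧ T.dist r w = k := by
  obtain ⟨p, hp⟩ := hT.exists_walk_length_eq_dist x r
  rw [dist_comm, h] at hp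
  cases p with
  | nil => simp at hp
  | @cons _ w _ hxw p =>
    simp only [Walk.length_cons, Nat.add_right_cancel_iff] at hp
    refine ⟨w, hxw, le_antisymm ?_ ?_⟩
    · rw [dist_comm, ← hp]
      exact dist_le p
    · have := hxw.diff_dist_adj (u := r)
      omega

/-- Uniqueness of the parent of `x` in the tree rooted at `r`: extending shortest walks to `w` and
`w'` by `x` gives two paths from `r` to `x`, which must coincide. -/
lemma eq_of_adj_of_dist_lt (hT : T.IsTree) {r x w w' : V} (hw : T.Adj w x) (hw' : T.Adj w' x)
    (hd : T.dist r x = T.dist r w + 1) (hd' : T.dist r x = T.dist r w' + 1) : w = w' := by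
  obtain ⟨p, hp⟩ := hT.connected.exists_walk_length_eq_dist r w
  obtain ⟨q, hq⟩ := hT.connected.exists_walk_length_eq_dist r w'
  have h1 : (p.concat hw).IsPath := (p.concat hw).isPath_of_length_eq_dist (by simp [hp, hd])
  have h2 : (q.concat hw').IsPath := (q.concat hw').isPath_of_length_eq_dist (by simp [hq, hd'])
  have h3 := congrArg Subtype.val
    ((hT.isAcyclic.subsingleton_path r x).elim ⟨_, h1⟩ ⟨_, h2⟩)
  simpa using congrArg Walk.penultimate h3

lemma exists_isLeaf [Finite V] [Nontrivial V] (hT : T.IsTree) : ∃ r, IsLeaf T r := by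
  classical
  have := Fintype.ofFinite V
  obtain ⟨r, hr⟩ := hT.exists_vert_degree_one_of_nontrivial
  exact ⟨r, degree_eq_one_iff_existsUnique_adj.1 hr⟩

lemma nonempty_iso_pathGraph_two {a b : V} (hab : T.Adj a b) (h : ∀ x, x = a ∨ x = b) :
    Nonempty (T ≃g pathGraph 2) := by
  have hf : Function.Bijective ![a, b] := by
    constructor
    · intro i j hij
      fin_cases i <;> fin_cases j <;> simp_all [hab.ne, hab.ne']
    · intro x
      rcases h x with rfl | rfl
      · exact ⟨0, rfl⟩
      · exact ⟨1, rfl⟩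
  refine ⟨Iso.symm ⟨Equiv.ofBijective _ hf, ?_⟩⟩
  intro i j
  fin_cases i <;> fin_cases j <;> simp [pathGraph_adj, hab, hab.symm]

lemma nonempty_iso_pathGraph_one [Nonempty V] [Subsingleton V] :
    Nonempty (T ≃g pathGraph 1) := by
  have : Unique V := ⟨⟨Classical.arbitrary V⟩, fun _ => Subsingleton.elim _ _⟩
  refine ⟨⟨Equiv.ofUnique V (Fin 1), ?_⟩⟩
  intro a b
  obtain rfl := Subsingleton.elim a b
  simp

lemma exists_iso_appendPath_of_isLeaf {l s : V} (hl : IsLeaf T l) (hs : T.Adj s l) :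
    ∃ (S : Set V) (y : S), y.1 = s ∧ (∀ x, x ≠ l → x ∈ S) ∧
      ∃ e : T ≃g appendPath (T.induce S) y 0, e l = .inr 0 := by
  have : Subsingleton (Fin (0 + 1)) := inferInstanceAs (Subsingleton (Fin 1))
  have hmem : ∀ x, x ≠ l → x ∈ (Set.range fun _ : Fin (0 + 1) => l)ᶜ := fun x hx => by
    simpa [eq_comm] using hx
  obtain ⟨e, he⟩ := exists_iso_appendPath (G := T) (fun _ : Fin (0 + 1) => l)
    (Function.injective_of_subsingleton _) (hmem s hs.ne) (fun i j => by
      rw [Subsingleton.elim i j]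
      simp) (fun a _ i => by
      rw [Subsingleton.elim i 0]
      simp only [and_true]
      exact ⟨fun h => hl.unique h.symm hs.symm, fun h => h ▸ hs⟩)
  exact ⟨_, _, rfl, hmem, e, he 0⟩

/-- Two leaves with a common neighbour: one of them can be split off. -/
lemma exists_iso_appendPath_zero {l l' s : V} (hll : l ≠ l') (hl : IsLeaf T l) (hl' : IsLeaf T l')
    (hs : T.Adj s l) (hs' : T.Adj s l') :
    ∃ (S : Set V) (y : S), Nonempty (T ≃g appendPath (T.induce S) y 0) ∧
      IsStem (T.induce S) y := by
  obtain ⟨S, y, rfl, hS, e, -⟩ := exists_iso_appendPath_of_isLeaf hl hs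
  refine ⟨S, y, ⟨e⟩, ⟨l', hS l' hll.symm⟩, hs', y, hs'.symm, ?_⟩
  rintro ⟨z, hz⟩ hlz
  exact Subtype.ext (hl'.unique hlz hs'.symm)

/-- A pendant path on three vertices can be split off. -/
lemma exists_iso_appendPath_two {v₀ v₁ v₂ v₃ : V} (h01 : T.Adj v₀ v₁) (h12 : T.Adj v₁ v₂)
    (h23 : T.Adj v₂ v₃) (h02 : v₀ ≠ v₂) (h03 : v₀ ≠ v₃) (h13 : v₁ ≠ v₃)
    (hnb₀ : ∀ {x}, T.Adj v₀ x → x = v₁) (hnb₁ : ∀ {x}, T.Adj v₁ x → x = v₀ ∨ x = v₂)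
    (hnb₂ : ∀ {x}, T.Adj v₂ x → x = v₁ ∨ x = v₃) :
    ∃ (S : Set V) (y : S), Nonempty (T ≃g appendPath (T.induce S) y 2) := by
  have hn02 : ¬ T.Adj v₀ v₂ := fun h => h12.ne (hnb₀ h).symm
  have hn20 : ¬ T.Adj v₂ v₀ := fun h => hn02 h.symm
  have hmem : ∀ x, x ∈ (Set.range ![v₂, v₁, v₀])ᶜ ↔ x ≠ v₂ ∧ x ≠ v₁ ∧ x ≠ v₀ := by
    intro x
    simp only [Set.mem_compl_iff, Set.mem_range, Fin.exists_fin_succ, Matrix.cons_val_zero,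
      Matrix.cons_val_succ, Fin.exists_fin_zero, or_false, not_or, ne_eq, eq_comm]
  have hinj : Function.Injective ![v₂, v₁, v₀] := by
    have := h01.ne
    have := h12.ne
    intro i j hij
    fin_cases i <;> fin_cases j <;> first | rfl | exact absurd hij (by simp [*, Ne.symm, eq_comm])
  have hpath : ∀ i j, T.Adj (![v₂, v₁, v₀] i) (![v₂, v₁, v₀] j) ↔ (pathGraph 3).Adj i j := by
    intro i j
    fin_cases i <;> fin_cases j <;>
      simp [pathGraph_adj, h01, h01.symm, h12, h12.symm, hn02, hn20]
  obtain ⟨e, -⟩ := exists_iso_appendPath (n := 2) _ hinj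
    ((hmem v₃).2 ⟨h23.ne', h13.symm, h03.symm⟩) hpath fun a ha i => by
      obtain ⟨ha2, ha1, ha0⟩ := (hmem a).1 ha
      fin_cases i
      · simp only [Fin.zero_eta, Matrix.cons_val_zero, and_true]
        exact ⟨fun h => (hnb₂ h.symm).resolve_left ha1, fun h => h ▸ h23.symm⟩
      · simp only [Fin.mk_one, Matrix.cons_val_one, Matrix.cons_val_zero]
        refine ⟨fun h => ?_, fun h => absurd h.2 (by decide)⟩
        rcases hnb₁ h.symm with h | h
        · exact absurd h ha0
        · exact absurd h ha2
      · exact ⟨fun h => absurd (hnb₀ h.symm) ha1, fun h => absurd h.2 (by decide)⟩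
  exact ⟨_, _, ⟨e⟩⟩

/-- A tree is `P₁` or `P₂`, or needs more guards for eternal domination than for domination, or
arises by appending a vertex to a stem or a path on three vertices. -/
theorem tree_decomposition [Finite V] (hT : T.IsTree) :
    Nonempty (T ≃g pathGraph 1) ∨ Nonempty (T ≃g pathGraph 2) ∨
      eternalDistDominationNumber T 2 ≠ distDominationNumber T 2 ∨
      ∃ (S : Set V) (y : S), (Nonempty (T ≃g appendPath (T.induce S) y 0) ∧
        IsStem (T.induce S) y) ∨ Nonempty (T ≃g appendPath (T.induce S) y 2) := by
  have := hT.connected.nonempty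
  rcases subsingleton_or_nontrivial V with hV | hV
  · exact .inl nonempty_iso_pathGraph_one
  right
  -- The root is a leaf so that depth two cannot occur later: there the root would be a second leaf
  -- beside `v₀` at `v₁`.
  obtain ⟨r, hr⟩ := exists_isLeaf hT
  have hadj : ∀ {a b}, T.Adj a b → T.dist r a = T.dist r b + 1 ∨ T.dist r b = T.dist r a + 1 := by
    intro a b hab
    have h1 := hab.diff_dist_adj (u := r)
    have h2 := hT.dist_ne_of_adj r hab
    omega
  obtain ⟨v₀, hmax⟩ := Finite.exists_max (T.dist r)
  have hpos : 0 < T.dist r v₀ := by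
    obtain ⟨x, hx⟩ := exists_ne r
    exact (hT.connected.pos_dist_of_ne hx.symm).trans_le (hmax x)
  have hdeep : ∀ {l s s'}, T.dist r l = T.dist r v₀ → T.Adj l s → T.Adj l s' → s = s' := by
    intro l s s' hl hs hs'
    have := hmax s
    have := hmax s'
    have := hadj hs
    have := hadj hs'
    exact eq_of_adj_of_dist_lt hT hs.symm hs'.symm (r := r) (by omega) (by omega)
  obtain ⟨H, hH⟩ := Nat.exists_eq_add_of_lt hpos
  rw [zero_add] at hH
  obtain ⟨v₁, h01, hv₁⟩ := exists_adj_dist_add_one hT.connected hH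
  have hleaf : ∀ {l}, T.Adj v₁ l → T.dist r l = H + 1 → IsLeaf T l := fun hl hd =>
    ⟨v₁, hl.symm, fun z hz => hdeep (hd.trans hH.symm) hz hl.symm⟩
  -- Children of `v₁` have maximal depth and are therefore leaves; without a twin of `v₀`, the
  -- vertex `v₁` has no other child.
  by_cases htwin : ∃ l, l ≠ v₀ ∧ IsLeaf T l ∧ T.Adj v₁ l
  · obtain ⟨l, hne, hl, hadj⟩ := htwin
    obtain ⟨S, y, h⟩ := exists_iso_appendPath_zero hne.symm (hleaf h01.symm hH) hl h01.symm hadj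
    exact .inr (.inr ⟨S, y, .inl h⟩)
  push Not at htwin
  have hchild : ∀ {l}, T.Adj v₁ l → T.dist r l = H + 1 → l = v₀ := fun hl hd => by
    by_contra hne
    exact htwin _ hne (hleaf hl hd) hl
  rcases H with _ | H
  · left
    obtain rfl : r = v₁ := (hT.connected.dist_eq_zero_iff).1 hv₁
    refine nonempty_iso_pathGraph_two h01.symm fun x => ?_
    have hx := hmax x
    rcases Nat.eq_zero_or_pos (T.dist r x) with h0 | h0
    · exact .inl ((hT.connected.dist_eq_zero_iff).1 h0).symm
    · have h1 : T.dist r x = 1 := by omega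
      exact .inr (hchild (dist_eq_one_iff_adj.1 h1) h1)
  right
  obtain ⟨v₂, h12, hv₂⟩ := exists_adj_dist_add_one hT.connected hv₁
  have hnb₁ : ∀ {x}, T.Adj v₁ x → x = v₀ ∨ x = v₂ := by
    intro x hx
    rcases hadj hx with h | h
    · exact .inr (eq_of_adj_of_dist_lt hT hx.symm h12.symm h (by omega))
    · exact .inl (hchild hx (by omega))
  have hnb₀ : ∀ {x}, T.Adj v₀ x → x = v₁ := fun hx => hdeep rfl hx h01
  have hnear₀ : ∀ {z}, T.edist v₀ z ≤ 2 → z = v₀ ∨ z = v₁ ∨ z = v₂ := by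
    intro z hz
    rcases edist_le_two_iff.1 hz with rfl | h | ⟨c, hc, hcz⟩
    · exact .inl rfl
    · exact .inr (.inl (hnb₀ h))
    · obtain rfl := hnb₀ hc
      rcases hnb₁ hcz with h | h <;> simp [h]
  rcases H with _ | H
  · exfalso
    obtain rfl : r = v₂ := (hT.connected.dist_eq_zero_iff).1 hv₂
    refine htwin r ?_ hr h12
    rintro rfl
    simp at hH
  -- Suppose `v₂` has a second child `w`. Its children are at maximal depth, so a guard on `v₂`
  -- covers everything a guard on `w` does. It also covers everything reached by a guard near `v₀`,
  -- which must be on `v₀`, `v₁` or `v₂`. An attack on `w` forces two guards that `v₂` alone could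
  -- replace.
  by_cases hw : ∃ w, w ≠ v₁ ∧ T.Adj v₂ w ∧ T.dist r w = H + 2
  · left
    obtain ⟨w, hne, h2w, hdw⟩ := hw
    refine eternal_ne_of_replace (a := w) (b := v₀) (c := v₂) ?_ ?_ ?_
    · intro h
      rcases hnear₀ h with rfl | rfl | rfl
      · omega
      · exact hne rfl
      · exact h2w.ne rfl
    · intro x hx
      rw [edist_le_two_iff]
      rcases edist_le_two_iff.1 hx with rfl | h | ⟨c, hc, hcx⟩
      · exact .inr (.inl h2w)
      · exact .inr (.inr ⟨w, h2w, h⟩)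
      · rcases hadj hc with h | h
        · obtain rfl := eq_of_adj_of_dist_lt hT hc.symm h2w h (by omega)
          exact .inr (.inl hcx)
        · obtain rfl := hdeep (show T.dist r c = T.dist r v₀ by omega) hc.symm hcx
          exact .inr (.inl h2w)
    · intro z hz x hx
      rw [edist_le_two_iff]
      rcases hnear₀ hz with rfl | rfl | rfl
      · rcases hnear₀ hx with rfl | rfl | rfl
        · exact .inr (.inr ⟨_, h12.symm, h01.symm⟩)
        · exact .inr (.inl h12.symm)
        · exact .inl rfl
      · rcases edist_le_two_iff.1 hx with rfl | h | ⟨c, hc, hcx⟩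
        · exact .inr (.inl h12.symm)
        · exact .inr (.inr ⟨_, h12.symm, h⟩)
        · rcases hnb₁ hc with rfl | rfl
          · obtain rfl := hnb₀ hcx
            exact .inr (.inl h12.symm)
          · exact .inr (.inl hcx)
      · exact edist_le_two_iff.1 hx
  right
  push Not at hw
  obtain ⟨v₃, h23, hv₃⟩ := exists_adj_dist_add_one hT.connected hv₂
  -- Now `v₂` has no child but `v₁`, so `v₂`, `v₁`, `v₀` form a pendant P₃ attached to `v₃`.
  have hnb₂ : ∀ {x}, T.Adj v₂ x → x = v₁ ∨ x = v₃ := by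
    intro x hx
    rcases hadj hx with h | h
    · exact .inr (eq_of_adj_of_dist_lt hT hx.symm h23.symm h (by omega))
    · by_contra! hne
      exact hw x hne.1 hx (by omega)
  obtain ⟨S, y, h⟩ := exists_iso_appendPath_two h01 h12 h23 (fun h => by subst h; omega)
    (fun h => by subst h; omega) (fun h => by subst h; omega) hnb₀ hnb₁ hnb₂
  exact ⟨S, y, .inr h⟩

/-- If a vertex `w` sees within distance two only the closed neighbourhood of `y`, then a path on
three vertices appended to `y` makes eternal domination expensive. -/
lemma eternal_ne_appendPath_two [Finite V] {y w : V}
    (hw : ∀ x, T.edist w x ≤ 2 → T.edist x y ≤ 1) :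
    eternalDistDominationNumber (appendPath T y 2) 2 ≠
      distDominationNumber (appendPath T y 2) 2 := by
  have hpath : ∀ i : Fin (2 + 1), (appendPath T y 2).edist (.inr 0) (.inr i) ≤ 2 := fun i =>
    edist_inr_inr_le_of_le (by simp) (by simp; omega)
  have hlast : ((2 : Fin (2 + 1)) : ℕ) = 2 := rfl
  -- A guard on the first path vertex covers the whole path and the closed neighbourhood of `y`.
  -- That is all that a guard on `w` together with a guard near the path's end can cover.
  refine eternal_ne_of_replace (a := .inl w) (b := .inr 2) (c := .inr 0) ?_ ?_ ?_
  · intro h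
    rw [edist_comm] at h
    have := (edist_inl_inr_le_two h).2
    omega
  · rintro (x | i) h
    · rw [edist_comm]
      exact edist_inl_inr_zero_le_two (hw x (by simpa using h))
    · exact hpath i
  · rintro (z | j) hz (x | i) hx
    · rw [edist_comm] at hz
      have := (edist_inl_inr_le_two hz).2
      omega
    · exact hpath i
    · rw [edist_comm] at hx ⊢
      exact edist_inl_inr_zero_le_two (edist_inl_inr_le_two hx).1
    · exact hpath i

/-- The witness is a leaf at `y`: everything within two of it is reached through `y`. -/
lemma IsStem.exists_edist_le_two_imp {y : V} (hy : IsStem T y) :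
    ∃ w, ∀ x, T.edist w x ≤ 2 → T.edist x y ≤ 1 := by
  obtain ⟨l, hyl, hl⟩ := hy
  refine ⟨l, fun x hx => ?_⟩
  rw [edist_le_one_iff_adj_or_eq]
  rcases edist_le_two_iff.1 hx with rfl | h | ⟨c, hc, hcx⟩
  · exact .inl hyl.symm
  · exact .inr (hl.unique h hyl.symm)
  · obtain rfl := hl.unique hc hyl.symm
    exact .inl hcx.symm

/-- The guard covering an old leaf at `y` lies in the closed neighbourhood of `y` and so covers the
new leaf as well. -/
lemma distDominationNumber_appendPath_zero_le [Finite V] {y : V} (hy : IsStem T y) :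
    distDominationNumber (appendPath T y 0) 2 ≤ distDominationNumber T 2 := by
  classical
  obtain ⟨D, hc, hD⟩ := exists_isDistDominating_card T 2
  rw [← hc]
  refine (distDominationNumber_le (D := D.map .inl) ?_).trans (Finset.card_map _).le
  rintro (x | i) -
  · obtain ⟨w, hw, hd⟩ := hD.exists_edist_le x
    exact ⟨.inl w, by simpa using hw, by simpa using hd⟩
  · obtain ⟨l, hl⟩ := hy.exists_edist_le_two_imp
    obtain ⟨w, hw, hd⟩ := hD.exists_edist_le l
    refine ⟨.inl w, by simpa using hw, ?_⟩
    rw [edist_comm, Fin.fin_one_eq_zero i]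
    exact edist_inl_inr_zero_le_two (hl w hd)

/-- A dominating set of the graph with a leaf at `z` spends a vertex on `z` or that leaf. Trading it
for the second vertex of the P₄ covers the path and `z`. Only neighbours of `z` may lose their
dominator, and these are still within two of the remaining set because none of them is a leaf. -/
lemma distDominationNumber_appendPath_three_le [Finite V] {z : V} (hT : T.IsTree)
    (hz : ¬ IsStem T z) :
    distDominationNumber (appendPath T z 3) 2 ≤ dominationNumber (appendPath T z 0) := by
  classical
  obtain ⟨D, hc, hD⟩ := exists_isDominating_card (appendPath T z 0)
  rw [← hc]
  let E : Finset V := (D.preimage Sum.inl Sum.inl_injective.injOn).erase z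
  have hE : ∀ x, x ∈ E ↔ x ≠ z ∧ .inl x ∈ D := by simp [E]
  have hmiss : ∃ s ∈ D, s ∉ E.map Function.Embedding.inl := by
    obtain ⟨x | i, hs, hd⟩ := hD.exists_edist_le (.inr 0)
    · refine ⟨_, hs, ?_⟩
      rcases edist_le_one_iff_adj_or_eq.1 hd with h | h
      · simp [hE, (appendPath_adj_inr_inl.1 h).1]
      · simp at h
    · exact ⟨_, hs, by simp⟩
  have hcard : E.card + 1 ≤ D.card := by
    obtain ⟨s, hs, hsE⟩ := hmiss
    rw [← Finset.card_map Function.Embedding.inl, ← Finset.card_insert_of_notMem hsE]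
    refine Finset.card_le_card (Finset.insert_subset hs ?_)
    intro t ht
    obtain ⟨x, hx, rfl⟩ := Finset.mem_map.1 ht
    exact ((hE x).1 hx).2
  have hnear : ∀ x, x ≠ z → ¬ T.Adj x z → ∃ w ∈ E, T.edist x w ≤ 1 := by
    intro x hx hxz
    obtain ⟨w | i, hw, hd⟩ := hD.exists_edist_le (.inl x)
    · rw [edist_inl_inl] at hd
      refine ⟨w, (hE w).2 ⟨?_, hw⟩, hd⟩
      rintro rfl
      exact (edist_le_one_iff_adj_or_eq.1 hd).elim hxz hx
    · rcases edist_le_one_iff_adj_or_eq.1 hd with h | h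
      · exact absurd (appendPath_adj_inl_inr.1 h).1 hx
      · simp at h
  refine (distDominationNumber_le (D := insert (.inr 1) (E.map .inl)) ?_).trans
    ((Finset.card_insert_le _ _).trans (by rwa [Finset.card_map]))
  rintro (x | i) -
  · by_cases hx : x = z
    · refine ⟨.inr 1, by simp, ?_⟩
      rw [hx, edist_inl_inr]
      simp
    suffices h : ∃ w ∈ E, T.edist x w ≤ 2 by
      obtain ⟨w, hw, hd⟩ := h
      exact ⟨.inl w, by simpa using hw, by simpa using hd⟩
    by_cases hxz : T.Adj x z
    -- A second neighbour `x'` of `x` is not adjacent to `z`, as a tree has no triangle, so it is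
    -- still dominated and passes its dominator on to `x` at distance two.
    · have hnl : ∃ x', T.Adj x x' ∧ x' ≠ z := by
        by_contra! h
        exact hz ⟨x, hxz.symm, z, hxz, h⟩
      obtain ⟨x', hxx', hx'⟩ := hnl
      have htri : ¬ T.Adj x' z := fun h => by
        refine hT.dist_ne_of_adj z hxx' ?_
        rw [dist_eq_one_iff_adj.2 hxz.symm, dist_eq_one_iff_adj.2 h.symm]
      obtain ⟨w, hw, hd⟩ := hnear x' hx' htri
      exact ⟨w, hw, edist_le_two_of_le_one (edist_eq_one_iff_adj.2 hxx').le hd⟩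
    · obtain ⟨w, hw, hd⟩ := hnear x hx hxz
      exact ⟨w, hw, hd.trans (by norm_num)⟩
  · refine ⟨.inr 1, by simp, edist_inr_inr_le_of_le ?_ ?_⟩
    · have : ((1 : Fin (3 + 1)) : ℕ) = 1 := rfl
      omega
    · simp

end Trees

/-! ### Induction on the order and conclusion -/

section Main

variable {V : Type u} {T : SimpleGraph V}

lemma inFamily_iff_generated {y : V} (hy : ∃ x, T.Adj x y) : InFamily T ↔ Generated V T := by
  refine ⟨fun h => h.resolve_left ?_, .inr⟩
  rintro ⟨e⟩
  obtain ⟨x, hx⟩ := hy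
  have : Subsingleton V := e.toEquiv.subsingleton
  exact hx.ne (Subsingleton.elim _ _)

/-- Writing T⁺ for the enlarged graph, γ_all,2^∞(T) + 1 ≤ γ_all,2^∞(T⁺) = γ₂(T⁺) ≤ γ₂(T) + 1 ≤
γ_all,2^∞(T) + 1, so all terms agree. -/
lemma eternal_eq_of_appendPath [Finite V] {y : V} {n : ℕ} (hn : 2 ≤ n) (hn' : n ≤ 3)
    (h : eternalDistDominationNumber (appendPath T y n) 2 =
      distDominationNumber (appendPath T y n) 2) :
    eternalDistDominationNumber T 2 = distDominationNumber T 2 ∧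
      distDominationNumber (appendPath T y n) 2 = distDominationNumber T 2 + 1 := by
  have h1 := eternal_add_one_le_appendPath (G := T) (y := y) hn
  have h2 := distDominationNumber_appendPath_le (G := T) (y := y) hn' (by omega)
  have h3 := distDominationNumber_le_eternal T
  omega

lemma card_lt_of_iso_appendPath {W : Type u} [Finite W] [Finite V] {H : SimpleGraph W} {y : V}
    {n : ℕ} (e : H ≃g appendPath T y n) : Nat.card V < Nat.card W := by
  rw [Nat.card_congr e.toEquiv, Nat.card_sum, Nat.card_fin]
  omega

/-- A tree whose eternal distance-two domination number equals its distance-two domination number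
belongs to the family. -/
theorem inFamily_of_eternal_eq (m : ℕ) : ∀ (V : Type u) [Finite V] (T : SimpleGraph V), T.IsTree →
    Nat.card V = m → eternalDistDominationNumber T 2 = distDominationNumber T 2 → InFamily T := by
  induction m using Nat.strong_induction_on with
  | _ m ih =>
  intro V _ T hT hm heq
  rcases tree_decomposition hT with h | h | h | ⟨S, y, ⟨⟨e⟩, hy⟩ | ⟨⟨e⟩⟩⟩
  · exact .inl h
  · exact .inr (.base h)
  · exact absurd heq h
  · have hS : (T.induce S).IsTree := isTree_of_isTree_appendPath (e.isTree_iff.1 hT)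
    obtain ⟨l, hyl, hl⟩ := id hy
    have hA : eternalDistDominationNumber (T.induce S) 2 = distDominationNumber (T.induce S) 2 := by
      refine le_antisymm ?_ (distDominationNumber_le_eternal _)
      have h1 := eternalDistDominationNumber_le_of_surjective
        (isWeakHom_retract (G := T.induce S) (y := y) (n := 0)) (retract_surjective y 0)
      rw [← eternalDistDominationNumber_congr e, heq, distDominationNumber_congr 2 e] at h1
      exact h1.trans (distDominationNumber_appendPath_zero_le hy)
    have hF := ih _ (hm ▸ card_lt_of_iso_appendPath e) _ _ hS rfl hA
    exact .inr (.op₁ y ((inFamily_iff_generated ⟨l, hyl.symm⟩).1 hF) hy ⟨e⟩)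
  · have hS : (T.induce S).IsTree := isTree_of_isTree_appendPath (e.isTree_iff.1 hT)
    rw [eternalDistDominationNumber_congr e, distDominationNumber_congr 2 e] at heq
    obtain ⟨hA, hcount⟩ := eternal_eq_of_appendPath le_rfl (by norm_num) heq
    have hF := ih _ (hm ▸ card_lt_of_iso_appendPath e) _ _ hS rfl hA
    by_cases hy : IsStem (T.induce S) y
    · obtain ⟨w, hw⟩ := hy.exists_edist_le_two_imp
      exact absurd heq (eternal_ne_appendPath_two hw)
    by_cases hyl : IsLeaf (T.induce S) y
    · obtain ⟨w, hyw, -⟩ := id hyl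
      obtain ⟨S', z, -, -, e', he'⟩ := exists_iso_appendPath_of_isLeaf hyl hyw.symm
      have hS' := isTree_of_isTree_appendPath (e'.isTree_iff.1 hS)
      -- The leaf `y` and the P₃ hanging from it are regrouped as a P₄ attached to the neighbour `z`
      -- of `y`.
      obtain ⟨e''⟩ := nonempty_appendPath_appendPath_iso (G := (T.induce S).induce S') z 2
      have e₂ := appendPathIso e' y 2
      rw [he'] at e₂
      have e₃ := e₂.trans e''
      by_cases hz : IsStem ((T.induce S).induce S') z
      · rw [eternalDistDominationNumber_congr e₃, distDominationNumber_congr 2 e₃] at heq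
        have hA' := (eternal_eq_of_appendPath (by norm_num) le_rfl heq).1
        have hF' := ih _ (hm ▸ card_lt_of_iso_appendPath (e.trans e₃)) _ _ hS' rfl hA'
        obtain ⟨l, hzl, -⟩ := id hz
        exact .inr (.op₃ z ((inFamily_iff_generated ⟨l, hzl.symm⟩).1 hF') hz ⟨e.trans e₃⟩)
      -- If `z` is not a stem after removal of `y`, then γ₂(T) ≤ γ(T − P₃) = γ₂(T − P₃), the
      -- equality by the induction hypothesis. This contradicts γ₂(T) = γ₂(T − P₃) + 1.
      · have h1 := distDominationNumber_appendPath_three_le hS' hz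
        rw [← distDominationNumber_congr 2 e₃, ← dominationNumber_congr e', hcount,
          hF.dominationNumber_eq] at h1
        omega
    · rcases hF with ⟨⟨e'⟩⟩ | hF
      · have : Subsingleton S := e'.toEquiv.subsingleton
        -- Here the remaining tree is P₁ and `T` is P₄, where equality fails; the isolated vertex
        -- `y` is itself the witness.
        refine absurd heq (eternal_ne_appendPath_two (w := y) fun x _ => ?_)
        rw [Subsingleton.elim x y]
        simp
      · exact .inr (.op₂ y hF hyl hy ⟨e⟩)

end Main

end EternalDomination

open EternalDomination in
theorem mainTheorem4 {V : Type*} [Finite V] (T : SimpleGraph V) (hT : T.IsTree) :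
    (eternalDistDominationNumber T 2 = distDominationNumber T 2 ↔ InFamily T) ∧
    (eternalDistDominationNumber T 2 = distDominationNumber T 2 ↔
      dominationNumber T = distDominationNumber T 2) := by
  have hAB := inFamily_of_eternal_eq _ V T hT rfl
  have hBC := InFamily.dominationNumber_eq (G := T)
  have h1 := distDominationNumber_le_eternal T
  have h2 := eternalDistDominationNumber_le_dominationNumber T
  have hCA : dominationNumber T = distDominationNumber T 2 →
      eternalDistDominationNumber T 2 = distDominationNumber T 2 :=
    fun h => le_antisymm (h ▸ h2) h1
  exact ⟨⟨hAB, fun h => hCA (hBC h)⟩, fun h => hBC (hAB h), hCA⟩
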